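/- **Model.** Let $\mathcal C$ be a set of $n$ customers and $\mathcal S$ a set of $m$ suppliers, with revenues $r_{ij}\ge 0$ and MNL preference weights $u_{ij}\ge 0$ (customer $i$ for supplier $j$) and $w_{ji}\ge 0$ (supplier $j$ for customer $i$), all outside options (denoted $0$) having weight $1$. Customer $i$, offered $S\subseteq\mathcal S$, chooses $j\in S$ with probability $\phi_i(j,S)=u_{ij}/(1+\sum_{\ell\in S}u_{i\ell})$ and the outside option with probability $\phi_i(0,S)=1/(1+\sum_{\ell\in S}u_{i\ell})$. For supplier $j$ and $C\subseteq\mathcal C$ let $$R_j(C)=\frac{\sum_{i\in C}r_{ij}w_{ji}}{1+\sum_{i\in C}w_{ji}},\qquad g_j(C)=\max_{C'\subseteq C}R_j(C').$$ An adaptive policy processes the customers one at a time; in each step it selects, depending on the choices observed so far, a customer not yet processed and an assortment of suppliers for her, and observes her choice. The backlog of supplier $j$ is the set of customers who have chosen $j$. After all customers have been processed, the policy offers every supplier a subset of its backlog, which earns $R_j$ of that subset in expectation from supplier $j$. Let $\mathsf{OPT}$ be the maximum expected revenue over adaptive policies, i.e. $\mathsf{OPT}=V(\mathcal C,(\emptyset)_j)$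 for the dynamic program $V(\emptyset,(C_j)_j)=\sum_j g_j(C_j)$ and $$V(\mathcal R,(C_j)_j)=\max_{i\in\mathcal R,\;S\subseteq\mathcal S}\;\sum_{\ell\in S\cup\{0\}}\phi_i(\ell,S)\,V\bigl(\mathcal R\setminus\{i\},(C_j^{i\to\ell})_j\bigr)\quad(\mathcal R\neq\emptyset),$$ where $(C_j^{i\to\ell})_j$ arises from $(C_j)_j$ by adding $i$ to $C_\ell$ (no change if $\ell=0$). **Theorem.** Suppose that all suppliers rank the customers in a common revenue order: there is an ordering $i_1,\dots,i_n$ of $\mathcal C$ with $r_{i_1j}\ge r_{i_2j}\ge\dots\ge r_{i_nj}$ for every $j\in\mathcal S$. For any such ordering consider the deterministic adaptive greedy algorithm that processes the customers in the order $i_1,\dots,i_n$, offers customer $i_t$, when the current backlogs are $(C_j)_j$, an assortment in $$\operatorname*{arg\,max}_{S\subseteq\mathcal S}\ \sum_{j\in S}\bigl(g_j(C_j\cup\{i_t\})-g_j(C_j)\bigr)\,\phi_{i_t}(j,S),$$ and at the end offers each supplier $j$ a subset of its backlog that maximizes $R_j$. Then, however ties are broken, this is a feasible adaptive policy, and its expected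 revenue is at least $\tfrac12\,\mathsf{OPT}$. Moreover, there is an implementation of this algorithm, which computes a common ordering from the revenues, sorts the alternatives of every assortment problem by their revenues (in the problem displayed above, by the marginal gains $g_j(C_j\cup\{i_t\})-g_j(C_j)$) and takes the best prefix, and whose total number of elementary steps (arithmetic operations on and comparisons of real numbers, table accesses, and list and tuple operations) is bounded by a polynomial in $n$ and $m$ on every instance that satisfies the hypothesis, whatever the customers choose. -/

import Mathlib

noncomputable section

namespace ATAR

/-! ## The two-sided platform -/

/-- An instance with `n` customers and `m` suppliers: the pair revenues `r i j`, the MNL preference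
weights `u i j` of customer `i` for supplier `j`, and the MNL preference weights `w j i` of supplier
`j` for customer `i`.  All outside options have weight `1`. -/
structure Instance (n m : ℕ) where
  r : Fin n → Fin m → ℝ
  u : Fin n → Fin m → ℝ
  w : Fin m → Fin n → ℝ
  r_nonneg : ∀ i j, 0 ≤ r i j
  u_nonneg : ∀ i j, 0 ≤ u i j
  w_nonneg : ∀ j i, 0 ≤ w j i

/-- MNL choice probabilities over a set `A` of alternatives with preference weights `v`;
`none` is the outside option. -/
def mnl {ι : Type} [DecidableEq ι] (v : ι → ℝ) (A : Finset ι) : Option ι → ℝ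
  | none => 1 / (1 + ∑ k ∈ A, v k)
  | some a => if a ∈ A then v a / (1 + ∑ k ∈ A, v k) else 0

/-- The backlogs of all suppliers: `B j` is the set of customers that have chosen supplier `j`. -/
abbrev Backlogs (n m : ℕ) : Type := Fin m → Finset (Fin n)

/-- The backlogs after customer `i` has made the choice `c`. -/
def Backlogs.record {n m : ℕ} (B : Backlogs n m) (i : Fin n) : Option (Fin m) → Backlogs n m
  | none => B
  | some j => Function.update B j (insert i (B j))

namespace Instance

variable {n m : ℕ} (I : Instance n m)

/-- `φ_i(c, S)`: the probability that customer `i`, offered the assortment `S`, chooses `c`. -/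
def custProb (i : Fin n) (c : Option (Fin m)) (S : Finset (Fin m)) : ℝ := mnl (I.u i) S c

/-- `φ_j(c, C)`: the probability that supplier `j`, offered the customers `C`, chooses `c`. -/
def suppProb (j : Fin m) (c : Option (Fin n)) (C : Finset (Fin n)) : ℝ := mnl (I.w j) C c

/-- `R_j(C)`: the expected revenue of offering the customers `C` to supplier `j`. -/
def R (j : Fin m) (C : Finset (Fin n)) : ℝ := ∑ i ∈ C, I.r i j * I.suppProb j (some i) C

/-- `g_j(C)`: the largest expected revenue of offering a subset of `C` to supplier `j`. -/
def g (j : Fin m) (C : Finset (Fin n)) : ℝ :=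
  C.powerset.sup' (Finset.powerset_nonempty C) (I.R j)

/-- `g_j(i | C) = g_j(C ∪ {i}) - g_j(C)`. -/
def marginal (j : Fin m) (i : Fin n) (C : Finset (Fin n)) : ℝ := I.g j (insert i C) - I.g j C

/-! ## The optimum, by dynamic programming -/

/-- The value-to-go with `k` steps left, `rem` the set of customers still to be processed and
backlogs `B`; it is used with `k = |rem|`. -/
def valueToGo : (k : ℕ) → (rem : Finset (Fin n)) → Backlogs n m → ℝ
  | 0, _, B => ∑ j, I.g j (B j)
  | k + 1, rem, B =>
    if h : rem.Nonempty then
      rem.sup' h fun i =>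
        (Finset.univ : Finset (Finset (Fin m))).sup' Finset.univ_nonempty fun S =>
          ∑ c ∈ Finset.insertNone S,
            I.custProb i c S * valueToGo k (rem.erase i) (B.record i c)
    else ∑ j, I.g j (B j)

/-- `OPT`, the optimal expected revenue over adaptive policies. -/
def OPT : ℝ := I.valueToGo n Finset.univ (fun _ => ∅)

end Instance

/-! ## Adaptive policies -/

/-- A deterministic adaptive policy as a decision tree.  `offer i S next` processes customer `i`,
offers her the assortment `S` and, having observed her choice `c`, continues with `next c`;
`finish D` offers every supplier `j` the customers `D j`. -/
inductive Policy (n m : ℕ) : Type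
  | finish (D : Fin m → Finset (Fin n)) : Policy n m
  | offer (i : Fin n) (S : Finset (Fin m)) (next : Option (Fin m) → Policy n m) : Policy n m

/-- The tree is a legitimate continuation when the customers `rem` are still to be processed and the
backlogs are `B`: every remaining customer is processed exactly once, and afterwards every supplier
is offered a subset of its backlog. -/
def Policy.Feasible {n m : ℕ} : Policy n m → Finset (Fin n) → Backlogs n m → Prop
  | .finish D, rem, B => rem = ∅ ∧ ∀ j, D j ⊆ B j
  | .offer i S next, rem, B =>
    i ∈ rem ∧ ∀ c ∈ Finset.insertNone S, (next c).Feasible (rem.erase i) (B.record i c)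

namespace Instance

variable {n m : ℕ} (I : Instance n m)

/-- The expected revenue of a policy. -/
def revenue : Policy n m → ℝ
  | .finish D => ∑ j, I.R j (D j)
  | .offer i S next => ∑ c ∈ Finset.insertNone S, I.custProb i c S * revenue (next c)

/-- `σ` lists the customers in descending order of revenue, for all suppliers simultaneously. -/
def IsCommonOrder (σ : Equiv.Perm (Fin n)) : Prop :=
  ∀ j : Fin m, ∀ s t : Fin n, s ≤ t → I.r (σ t) j ≤ I.r (σ s) j

/-- The objective that the greedy assortment for customer `i` maximizes, at backlogs `B`. -/
def greedyObjective (i : Fin n) (B : Backlogs n m) (S : Finset (Fin m)) : ℝ :=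
  ∑ j ∈ S, I.marginal j i (B j) * I.custProb i (some j) S

/-- The policy is a run of the greedy algorithm from backlogs `B`, with the customers of the list
still to be processed, in that order: each of them is offered some assortment that maximizes the
expected marginal gain (ties may be broken in any way, also depending on the past), and at the end
every supplier is offered some revenue-maximizing subset of its backlog. -/
def IsGreedy : List (Fin n) → Backlogs n m → Policy n m → Prop
  | [], B, .finish D => ∀ j, D j ⊆ B j ∧ ∀ C ⊆ B j, I.R j C ≤ I.R j (D j)
  | i :: L, B, .offer i' S next =>
    i' = i ∧ (∀ S' : Finset (Fin m), I.greedyObjective i B S' ≤ I.greedyObjective i B S) ∧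
      ∀ c ∈ Finset.insertNone S, IsGreedy L (B.record i c) (next c)
  | [], _, .offer _ _ _ => False
  | _ :: _, _, .finish _ => False

end Instance

/-! ## An implementation of the greedy algorithm, with its number of elementary steps

The computations below are written in a step-counting monad.  One step is one arithmetic operation
on reals, one comparison of reals, one access to a table, or one list or tuple operation. -/

/-- A result together with the number of elementary steps spent on computing it. -/
structure Timed (α : Type) where
  val : α
  time : ℕ

instance : Monad Timed where
  pure a := ⟨a, 0⟩
  bind x f := ⟨(f x.val).val, x.time + (f x.val).time⟩

/-- One elementary step. -/
def step {α : Type} (a : α) : Timed α := ⟨a, 1⟩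

/-- Apply a computation to the elements of a list, one after the other. -/
def forEach {α β : Type} (f : α → Timed β) : List α → Timed (List β)
  | [] => step []
  | x :: xs => do
    let y ← f x
    let ys ← forEach f xs
    step (y :: ys)

/-- Insertion into a list that is sorted in descending order of the keys. -/
def insertDesc {α : Type} (key : α → ℝ) (x : α) : List α → Timed (List α)
  | [] => step [x]
  | y :: ys => do
    let b ← step (decide (key y ≤ key x))
    if b then step (x :: y :: ys)
    else
      let zs ← insertDesc key x ys
      step (y :: zs)

/-- Insertion sort, in descending order of the keys. -/
def sortDesc {α : Type} (key : α → ℝ) : List α → Timed (List α)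
  | [] => step []
  | x :: xs => do
    let ys ← sortDesc key xs
    insertDesc key x ys

/-- An alternative in an assortment problem. -/
structure Item (ι : Type) where
  label : ι
  rev : ℝ
  wt : ℝ

/-- Runs through the prefixes of a list of items, and returns the largest MNL revenue of a prefix
together with the labels of this prefix.  `num`, `den` and `pre` are the numerator and the
denominator of the revenue of the current prefix and its labels; `best` and `bestPre` are the largest
revenue found so far and the labels of its prefix. -/
def scan {ι : Type} : List (Item ι) → (num den : ℝ) → (pre : List ι) → (best : ℝ) →
    (bestPre : List ι) → Timed (ℝ × List ι)
  | [], _, _, _, best, bestPre => step (best, bestPre)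
  | x :: xs, num, den, pre, best, bestPre => do
    let p ← step (x.rev * x.wt)
    let num' ← step (num + p)
    let den' ← step (den + x.wt)
    let v ← step (num' / den')
    let pre' ← step (x.label :: pre)
    let b ← step (decide (best < v))
    if b then scan xs num' den' pre' v pre' else scan xs num' den' pre' best bestPre

/-- MNL assortment optimization without constraints: sort by revenue, return the best prefix and its
revenue. -/
def mnlOpt {ι : Type} (items : List (Item ι)) : Timed (ℝ × List ι) := do
  let sorted ← sortDesc Item.rev items
  scan sorted 0 1 [] 0 []

namespace Instance

variable {n m : ℕ} (I : Instance n m)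

/-- A revenue-maximizing subset of the customers `L` for supplier `j`, and its revenue. -/
def bestSubset (j : Fin m) (L : List (Fin n)) : Timed (ℝ × List (Fin n)) := do
  let items ← forEach (fun i => do
    let a ← step (I.r i j)
    let v ← step (I.w j i)
    step (Item.mk i a v)) L
  mnlOpt items

/-- The greedy assortment for customer `i` when the backlogs are listed by `B`. -/
def greedyOffer (i : Fin n) (B : Fin m → List (Fin n)) : Timed (List (Fin m)) := do
  let items ← forEach (fun j => do
    let old ← step (B j)
    let new ← step (i :: old)
    let before ← I.bestSubset j old
    let after ← I.bestSubset j new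
    let a ← step (after.1 - before.1)
    let v ← step (I.u i j)
    step (Item.mk j a v)) (List.finRange m)
  let best ← mnlOpt items
  step best.2

/-- The listed backlogs after customer `i` has made the choice `c`. -/
def recordList (B : Fin m → List (Fin n)) (i : Fin n) : Option (Fin m) → Fin m → List (Fin n)
  | none => B
  | some j => Function.update B j (i :: B j)

/-- Sum of a list of reals. -/
def sumList : List ℝ → Timed ℝ
  | [] => step 0
  | x :: xs => do
    let s ← sumList xs
    step (x + s)

/-- The customers in descending order of their total revenue. -/
def customerOrder : Timed (List (Fin n)) := do
  let items ← forEach (fun i => do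
    let row ← forEach (fun j => step (I.r i j)) (List.finRange m)
    let s ← sumList row
    step (i, s)) (List.finRange n)
  let sorted ← sortDesc Prod.snd items
  forEach (fun p => step p.1) sorted

/-- The policy that results from processing the customers of the list from the listed backlogs `B`,
and the number of elementary steps that this takes in total for the worst sequence of customer
choices. Two steps are charged for recording each choice, and one for each supplier's final offer. -/
def greedyRun : List (Fin n) → (Fin m → List (Fin n)) → Timed (Policy n m)
  | [], B =>
    { val := .finish fun j => (I.bestSubset j (B j)).val.2.toFinset
      time := ∑ j, ((I.bestSubset j (B j)).time + 1) }
  | i :: L, B =>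
    { val := .offer i (I.greedyOffer i B).val.toFinset fun c => (greedyRun L (recordList B i c)).val
      time := (I.greedyOffer i B).time + 2 +
        Finset.univ.sup fun c : Option (Fin m) => (greedyRun L (recordList B i c)).time }

/-- The same-order greedy algorithm: the policy that it follows, and its worst-case number of
elementary steps. One step is charged per supplier for setting up the empty backlogs. -/
def sameOrderGreedy : Timed (Policy n m) :=
  let order := I.customerOrder
  let run := I.greedyRun order.val fun _ => []
  { val := run.val
    time := order.time + m + run.time }

end Instance

end ATAR

end

/-! The guarantee is a dual-fitting argument. A greedy run defines prices: `p i j` is the expected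
marginal gain of customer `i` for supplier `j` at the backlogs present when `i` is processed, and `q
i` is the expected greedy objective in that step. Greedy maximizes this objective, so under any
assortment the expected price of `i`'s choice is at most `q i`; and since the backlogs start empty
with value zero, the `q i` add up to the greedy revenue.

The prices also cover any final backlogs `O`: their value is at most the greedy revenue plus the
prices of the pairs in `O` (`IsGreedy.exists_prices`). To see this, merge `O` with the backlogs that
greedy builds. A customer added to the merged backlog gains at most what she gains at the smaller
greedy backlog, because everyone already present is worth at least as much as she is
(`marginal_anti`). This is where the common order enters: `g` need not have decreasing marginal
gains when customers arrive in another order. An induction over the dynamic program (`valueToGo_le`)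
then bounds the optimum by the greedy revenue plus the sum of the `q i`, that is, by twice the
greedy revenue.

For the implementation, an optimal MNL assortment consists of the alternatives worth more than the
optimal revenue, hence is a prefix after sorting (`mnlOpt_spec`); and sorting by total revenue
recovers a common order whenever one exists (`exists_isCommonOrder_customerOrder`). -/

namespace ATAR

open Finset

/-! ## MNL revenues -/

/-- The expected revenue of the assortment `C`, where alternative `x` has revenue `a x` and
preference weight `v x`. -/
noncomputable def mnlRevenue {ι : Type} (a v : ι → ℝ) (C : Finset ι) : ℝ :=
  (∑ x ∈ C, a x * v x) / (1 + ∑ x ∈ C, v x)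

section mnlRevenue

variable {ι : Type} {a v : ι → ℝ}

theorem one_add_sum_pos (hv : ∀ x, 0 ≤ v x) (C : Finset ι) : 0 < 1 + ∑ x ∈ C, v x := by
  have := sum_nonneg fun x (_ : x ∈ C) => hv x
  linarith

@[simp] theorem mnlRevenue_empty : mnlRevenue a v ∅ = 0 := by simp [mnlRevenue]

/-- Clearing the denominator makes the fractional objective additive: each alternative contributes
its weighted excess over `z`, so alternatives can be compared one at a time. -/
theorem mnlRevenue_le_iff (hv : ∀ x, 0 ≤ v x) (C : Finset ι) (z : ℝ) :
    mnlRevenue a v C ≤ z ↔ ∑ x ∈ C, v x * (a x - z) ≤ z := by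
  have h : ∑ x ∈ C, v x * (a x - z) = ∑ x ∈ C, a x * v x - z * ∑ x ∈ C, v x := by
    rw [mul_sum, ← sum_sub_distrib]
    exact sum_congr rfl fun x _ => by ring
  rw [mnlRevenue, div_le_iff₀ (one_add_sum_pos hv C), h]
  constructor <;> intro h <;> linarith

theorem mnlRevenue_mul (hv : ∀ x, 0 ≤ v x) (C : Finset ι) :
    mnlRevenue a v C * (1 + ∑ x ∈ C, v x) = ∑ x ∈ C, a x * v x :=
  div_mul_cancel₀ _ (one_add_sum_pos hv C).ne'

/-- An assortment that contains exactly the alternatives that are worth more than a bound on its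
revenue is at least as good as any other. -/
theorem mnlRevenue_le_of_threshold (hv : ∀ x, 0 ≤ v x) {C D T : Finset ι} {z : ℝ} (hC : C ⊆ D)
    (hT : ∀ x ∈ T, z ≤ a x) (hD : ∀ x ∈ D, x ∉ T → a x ≤ z)
    (hz : mnlRevenue a v T ≤ z) : mnlRevenue a v C ≤ z := by
  classical
  rw [mnlRevenue_le_iff hv] at hz ⊢
  refine le_trans ?_ hz
  -- Dropping alternatives worth at most `z` and adding ones worth at least `z` can only increase
  -- the total excess.
  calc ∑ x ∈ C, v x * (a x - z) ≤ ∑ x ∈ C with x ∈ T, v x * (a x - z) := by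
        rw [sum_filter]
        refine sum_le_sum fun x hx => ?_
        split_ifs with h
        · exact le_rfl
        · exact mul_nonpos_of_nonneg_of_nonpos (hv x) (sub_nonpos.2 (hD x (hC hx) h))
    _ ≤ _ := sum_le_sum_of_subset_of_nonneg (fun x hx => (mem_filter.1 hx).2)
        fun x hx _ => mul_nonneg (hv x) (sub_nonneg.2 (hT x hx))

/-- The new revenue is a weighted average of the old one and `a i`. In this form the increment
visibly decreases in the old revenue and in the old total weight. -/
theorem mnlRevenue_insert [DecidableEq ι] (hv : ∀ x, 0 ≤ v x) {C : Finset ι} {i : ι} (hi : i ∉ C) :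
    mnlRevenue a v (insert i C) =
      mnlRevenue a v C + v i * (a i - mnlRevenue a v C) / (1 + ∑ x ∈ C, v x + v i) := by
  have h1 := one_add_sum_pos hv C
  have h2 : 0 < 1 + ∑ x ∈ C, v x + v i := by linarith [hv i]
  have h3 := mnlRevenue_mul (a := a) hv C
  have h4 : 1 + ∑ x ∈ insert i C, v x = 1 + ∑ x ∈ C, v x + v i := by rw [sum_insert hi]; ring
  rw [mnlRevenue, h4, sum_insert hi, ← h3]
  field_simp
  ring

end mnlRevenue

/-! ### Supplier revenues and diminishing marginal gains -/

namespace Instance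

variable {n m : ℕ} (I : Instance n m)

theorem R_eq (j : Fin m) (C : Finset (Fin n)) :
    I.R j C = mnlRevenue (fun i => I.r i j) (I.w j) C := by
  rw [R, mnlRevenue, sum_div]
  exact sum_congr rfl fun i hi => by simp [suppProb, mnl, hi, mul_div_assoc]

theorem greedyObjective_eq (i : Fin n) (B : Backlogs n m) (S : Finset (Fin m)) :
    I.greedyObjective i B S = mnlRevenue (fun j => I.marginal j i (B j)) (I.u i) S := by
  rw [greedyObjective, mnlRevenue, sum_div]
  exact sum_congr rfl fun i hi => by simp [custProb, mnl, hi, mul_div_assoc]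

theorem R_le_g (j : Fin m) {C D : Finset (Fin n)} (h : C ⊆ D) : I.R j C ≤ I.g j D :=
  le_sup' (I.R j) (mem_powerset.2 h)

theorem g_le_iff (j : Fin m) (C : Finset (Fin n)) (z : ℝ) :
    I.g j C ≤ z ↔ ∀ D ⊆ C, I.R j D ≤ z := by
  simp [g]

theorem g_eq_of_forall_le {j : Fin m} {C D : Finset (Fin n)} (h : D ⊆ C)
    (hD : ∀ C' ⊆ C, I.R j C' ≤ I.R j D) : I.g j C = I.R j D :=
  le_antisymm ((I.g_le_iff j C _).2 hD) (I.R_le_g j h)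

theorem g_mono (j : Fin m) {C D : Finset (Fin n)} (h : C ⊆ D) : I.g j C ≤ I.g j D :=
  (I.g_le_iff j C _).2 fun _ hC => I.R_le_g j (hC.trans h)

@[simp] theorem g_empty (j : Fin m) : I.g j ∅ = 0 := by
  simp [g, R]

theorem marginal_nonneg (j : Fin m) (i : Fin n) (C : Finset (Fin n)) : 0 ≤ I.marginal j i C :=
  sub_nonneg.2 (I.g_mono j (subset_insert i C))

/-- The whole backlog passes the threshold test at its own revenue, so nothing is gained by dropping
customers. -/
theorem g_eq_R {j : Fin m} {C : Finset (Fin n)} (h : ∀ k ∈ C, I.R j C ≤ I.r k j) :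
    I.g j C = I.R j C := by
  refine I.g_eq_of_forall_le Subset.rfl fun D hD => ?_
  simp only [R_eq] at h ⊢
  exact mnlRevenue_le_of_threshold (I.w_nonneg j) hD h (fun x hx h => (h hx).elim) le_rfl

/-- Marginal gains of a customer decrease, provided that no customer of the larger backlog is worth
less. -/
theorem marginal_anti {j : Fin m} {i : Fin n} {B X : Finset (Fin n)} (hBX : B ⊆ X)
    (hr : ∀ k ∈ X, I.r i j ≤ I.r k j) : I.marginal j i X ≤ I.marginal j i B := by
  have hw := I.w_nonneg j
  by_cases hiX : i ∈ X
  · simpa [marginal, hiX] using I.marginal_nonneg j i B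
  have hiB : i ∉ B := fun h => hiX (hBX h)
  rcases le_or_gt (I.r i j) (I.g j X) with hle | hlt
  -- A customer worth no more than the optimal revenue of `X` has nonpositive excess at that level,
  -- so including her never helps.
  · have : I.marginal j i X ≤ 0 := by
      rw [marginal, sub_nonpos, g_le_iff]
      intro D hD
      by_cases hi : i ∈ D
      · have hs : D.erase i ⊆ X := by rwa [← subset_insert_iff]
        have h0 := I.R_le_g j hs
        rw [R_eq, mnlRevenue_le_iff hw] at h0 ⊢
        rw [← add_sum_erase _ _ hi]
        have := mul_nonpos_of_nonneg_of_nonpos (hw i) (sub_nonpos.2 hle)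
        linarith
      · exact I.R_le_g j ((subset_insert_iff_of_notMem hi).1 hD)
    exact this.trans (I.marginal_nonneg j i B)
  -- Now everyone in sight is worth more than the optimal revenue of `X`, so offering the entire
  -- backlog is optimal for both `X` and `B`, and the insertion formula applies.
  · have hgX : I.g j X = I.R j X := I.g_eq_R fun k hk =>
      ((I.R_le_g j Subset.rfl).trans hlt.le).trans (hr k hk)
    have hgB : I.g j B = I.R j B := I.g_eq_R fun k hk =>
      ((I.R_le_g j hBX).trans hlt.le).trans (hr k (hBX hk))
    have hBle : I.R j B ≤ I.R j X := by rw [← hgX]; exact I.R_le_g j hBX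
    rw [hgX] at hlt
    have hW : ∑ x ∈ B, I.w j x ≤ ∑ x ∈ X, I.w j x :=
      sum_le_sum_of_subset_of_nonneg hBX fun x _ _ => hw x
    have pB := one_add_sum_pos hw B
    have pX := one_add_sum_pos hw X
    have hwi := hw i
    have eX : I.R j (insert i X) = I.R j X +
        I.w j i * (I.r i j - I.R j X) / (1 + ∑ x ∈ X, I.w j x + I.w j i) := by
      simp only [R_eq]; exact mnlRevenue_insert hw hiX
    have eB : I.R j (insert i B) = I.R j B +
        I.w j i * (I.r i j - I.R j B) / (1 + ∑ x ∈ B, I.w j x + I.w j i) := by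
      simp only [R_eq]; exact mnlRevenue_insert hw hiB
    -- `R j X` moves only a fraction of the way towards `r i j`, so full backlogs stay optimal after
    -- inserting `i`. For `B` the trivial bound `R ≤ g` suffices.
    have hle : I.R j (insert i X) ≤ I.r i j := by
      have : I.w j i * (I.r i j - I.R j X) / (1 + ∑ x ∈ X, I.w j x + I.w j i) ≤
          I.r i j - I.R j X := by
        rw [div_le_iff₀ (by linarith)]
        nlinarith
      linarith
    have hgiX : I.g j (insert i X) = I.R j (insert i X) := I.g_eq_R fun k hk => by
      rcases mem_insert.1 hk with rfl | hk
      · exact hle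
      · exact hle.trans (hr k hk)
    have hfrac : I.w j i * (I.r i j - I.R j X) / (1 + ∑ x ∈ X, I.w j x + I.w j i) ≤
        I.w j i * (I.r i j - I.R j B) / (1 + ∑ x ∈ B, I.w j x + I.w j i) := by
      have : 0 ≤ I.r i j - I.R j B := by linarith
      have : 0 < 1 + ∑ x ∈ B, I.w j x + I.w j i := by linarith
      gcongr
    have := I.R_le_g j (Subset.refl (insert i B))
    rw [marginal, marginal, hgiX, hgX, hgB]
    linarith

/-! ## Choice probabilities -/

theorem custProb_nonneg (i : Fin n) (c : Option (Fin m)) (S : Finset (Fin m)) :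
    0 ≤ I.custProb i c S := by
  have h := (one_add_sum_pos (I.u_nonneg i) S).le
  cases c with
  | none => exact div_nonneg zero_le_one h
  | some j =>
    simp only [custProb, mnl]
    split_ifs
    · exact div_nonneg (I.u_nonneg i j) h
    · exact le_rfl

theorem sum_custProb (i : Fin n) (S : Finset (Fin m)) :
    ∑ c ∈ insertNone S, I.custProb i c S = 1 := by
  have h := (one_add_sum_pos (I.u_nonneg i) S).ne'
  rw [sum_insertNone]
  have : ∑ j ∈ S, I.custProb i (some j) S = ∑ j ∈ S, I.u i j / (1 + ∑ k ∈ S, I.u i k) :=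
    sum_congr rfl fun j hj => by simp [custProb, mnl, hj]
  rw [this, ← sum_div]
  simp only [custProb, mnl]
  rw [← add_div, div_self h]

/-! ## The greedy algorithm against the optimum -/

/-- Weak duality: the right-hand side is a potential that dominates the terminal value. Processing
`i` releases `q i` from it, which pays for the expected price added by her choice. -/
theorem valueToGo_le {p : Fin n → Fin m → ℝ} {q : Fin n → ℝ} {c : ℝ} (hp : ∀ i j, 0 ≤ p i j)
    (hq : ∀ i S, ∑ j ∈ S, I.custProb i (some j) S * p i j ≤ q i)
    (hg : ∀ B : Backlogs n m, ∑ j, I.g j (B j) ≤ c + ∑ j, ∑ i ∈ B j, p i j)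
    (k : ℕ) (rem : Finset (Fin n)) (B : Backlogs n m) :
    I.valueToGo k rem B ≤ c + ∑ j, ∑ i ∈ B j, p i j + ∑ i ∈ rem, q i := by
  have hq0 : ∀ i, 0 ≤ q i := fun i => by simpa using hq i ∅
  have hend : ∀ (rem : Finset (Fin n)) (B : Backlogs n m),
      ∑ j, I.g j (B j) ≤ c + ∑ j, ∑ i ∈ B j, p i j + ∑ i ∈ rem, q i := fun rem B => by
    have := hg B
    have := sum_nonneg fun i (_ : i ∈ rem) => hq0 i
    linarith
  induction k generalizing rem B with
  | zero => exact hend rem B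
  | succ k ih =>
    rw [valueToGo]
    split_ifs with h
    · refine sup'_le _ _ fun i hi => sup'_le _ _ fun S _ => ?_
      have hrem := add_sum_erase _ q hi
      -- Only an inequality, since for arbitrary `B` the customer may already be in the backlog.
      have hrec : ∀ j, ∑ j', ∑ i' ∈ B.record i (some j) j', p i' j' ≤
          ∑ j', ∑ i' ∈ B j', p i' j' + p i j := by
        intro j
        rw [← add_sum_erase univ _ (mem_univ j), ← add_sum_erase univ (fun j => ∑ i ∈ B j, p i j)
          (mem_univ j)]
        have h1 : ∑ j' ∈ univ.erase j, ∑ i' ∈ B.record i (some j) j', p i' j' =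
            ∑ j' ∈ univ.erase j, ∑ i' ∈ B j', p i' j' :=
          sum_congr rfl fun j' hj' => by simp [Backlogs.record, ne_of_mem_erase hj']
        have h2 : ∑ i' ∈ B.record i (some j) j, p i' j ≤ p i j + ∑ i' ∈ B j, p i' j := by
          simp only [Backlogs.record, Function.update_self]
          by_cases hij : i ∈ B j
          · simp [hij, hp i j]
          · rw [sum_insert hij]
        linarith
      set K := c + ∑ j, ∑ i ∈ B j, p i j + ∑ i ∈ rem.erase i, q i with hK
      calc ∑ c ∈ insertNone S, I.custProb i c S * I.valueToGo k (rem.erase i) (B.record i c)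
          ≤ ∑ c ∈ insertNone S, I.custProb i c S * (K + c.elim 0 (p i)) := by
            refine sum_le_sum fun c _ => mul_le_mul_of_nonneg_left ?_ (I.custProb_nonneg i c S)
            refine (ih _ _).trans ?_
            cases c with
            | none => simp [hK, Backlogs.record]
            | some j => have := hrec j; simp only [Option.elim]; linarith
        _ = K + ∑ j ∈ S, I.custProb i (some j) S * p i j := by
            simp only [mul_add, sum_add_distrib, ← sum_mul, sum_custProb, one_mul]
            simp [sum_insertNone]
        _ ≤ K + q i := by linarith [hq i S]
        _ = _ := by rw [hK]; linarith
    · exact hend rem B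

/-- A run of the greedy algorithm yields prices `p` and, for each customer, an upper bound `q` on the
price that she pays in expectation; adding customers `O` to backlogs that comprise those of the run
gains at most the revenue of the run and the prices of `O`. -/
theorem IsGreedy.exists_prices {L : List (Fin n)} {B : Backlogs n m} {P : Policy n m}
    (hP : I.IsGreedy L B P) (hL : L.Nodup)
    (hs : L.Pairwise fun i k => ∀ j, I.r k j ≤ I.r i j) :
    ∃ (p : Fin n → Fin m → ℝ) (q : Fin n → ℝ), (∀ i j, 0 ≤ p i j) ∧
      (∀ i ∈ L, ∀ S, ∑ j ∈ S, I.custProb i (some j) S * p i j ≤ q i) ∧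
      ∑ j, I.g j (B j) + ∑ i ∈ L.toFinset, q i = I.revenue P ∧
      ∀ X O : Backlogs n m, (∀ j, B j ⊆ X j) → (∀ j, ∀ k ∈ X j, ∀ i ∈ L, I.r i j ≤ I.r k j) →
        (∀ j, O j ⊆ L.toFinset) →
        ∑ j, I.g j (X j ∪ O j) ≤ ∑ j, (I.g j (X j) - I.g j (B j)) + I.revenue P +
          ∑ j, ∑ i ∈ O j, p i j := by
  induction L generalizing B P with
  | nil =>
    cases P with
    | offer => exact hP.elim
    | finish D =>
      have hg : ∑ j, I.R j (D j) = ∑ j, I.g j (B j) :=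
        sum_congr rfl fun j _ => (I.g_eq_of_forall_le (hP j).1 (hP j).2).symm
      refine ⟨0, 0, fun _ _ => le_rfl, by simp, by simp [revenue, hg], fun X O _ _ hO => ?_⟩
      have hO' : ∀ j, O j = ∅ := fun j => subset_empty.1 (hO j)
      simp [hO', revenue, hg, sum_sub_distrib]
  | cons i L ih =>
    cases P with
    | finish => exact hP.elim
    | offer i' S next =>
      obtain ⟨rfl, hmax, hnext⟩ := hP
      obtain ⟨hiL, hL⟩ := List.nodup_cons.1 hL
      obtain ⟨his, hs⟩ := List.pairwise_cons.1 hs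
      -- Every branch of the decision tree has its own prices; choices outside the assortment get
      -- irrelevant zeros so that `choose` applies.
      have hex : ∀ c : Option (Fin m), ∃ pq : (Fin n → Fin m → ℝ) × (Fin n → ℝ),
          c ∈ insertNone S → (∀ i j, 0 ≤ pq.1 i j) ∧
          (∀ i ∈ L, ∀ S, ∑ j ∈ S, I.custProb i (some j) S * pq.1 i j ≤ pq.2 i) ∧
          ∑ j, I.g j (B.record i' c j) + ∑ i ∈ L.toFinset, pq.2 i = I.revenue (next c) ∧
          ∀ X O : Backlogs n m, (∀ j, B.record i' c j ⊆ X j) →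
            (∀ j, ∀ k ∈ X j, ∀ i ∈ L, I.r i j ≤ I.r k j) → (∀ j, O j ⊆ L.toFinset) →
            ∑ j, I.g j (X j ∪ O j) ≤ ∑ j, (I.g j (X j) - I.g j (B.record i' c j)) +
              I.revenue (next c) + ∑ j, ∑ i ∈ O j, pq.1 i j := by
        intro c
        by_cases hc : c ∈ insertNone S
        · obtain ⟨p, q, h⟩ := ih (hnext c hc) hL hs
          exact ⟨(p, q), fun _ => h⟩
        · exact ⟨(0, 0), fun h => (hc h).elim⟩
      choose pq hpq using hex
      have hφ : ∀ c, 0 ≤ I.custProb i' c S := fun c => I.custProb_nonneg i' c S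
      have hsum := I.sum_custProb i' S
      -- The greedy objective is exactly the expected one-step increase of the total backlog value.
      have hdrift : ∑ c ∈ insertNone S, I.custProb i' c S * ∑ j, I.g j (B.record i' c j) =
          ∑ j, I.g j (B j) + I.greedyObjective i' B S := by
        have : ∀ c, ∑ j, I.g j (B.record i' c j) =
            ∑ j, I.g j (B j) + c.elim 0 fun j => I.marginal j i' (B j) := by
          intro c
          cases c with
          | none => simp [Backlogs.record]
          | some j =>
            rw [← add_sum_erase univ _ (mem_univ j),
              ← add_sum_erase univ (fun j => I.g j (B j)) (mem_univ j)]
            have h1 : ∑ j' ∈ univ.erase j, I.g j' (B.record i' (some j) j') =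
                ∑ j' ∈ univ.erase j, I.g j' (B j') :=
              sum_congr rfl fun j' hj' => by simp [Backlogs.record, ne_of_mem_erase hj']
            rw [h1]
            simp only [Backlogs.record, Function.update_self, Option.elim, marginal]
            ring
        simp only [this, mul_add, sum_add_distrib, ← sum_mul, hsum, one_mul]
        simp [sum_insertNone, greedyObjective, mul_comm]
      -- The current customer is priced at her present marginal gains; later customers at the
      -- average of their branch prices.
      refine ⟨fun k j => if k = i' then I.marginal j i' (B j) else
          ∑ c ∈ insertNone S, I.custProb i' c S * (pq c).1 k j,
        fun k => if k = i' then I.greedyObjective i' B S else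
          ∑ c ∈ insertNone S, I.custProb i' c S * (pq c).2 k, ?_, ?_, ?_, ?_⟩
      · intro k j
        dsimp only
        split_ifs
        · exact I.marginal_nonneg _ _ _
        · exact sum_nonneg fun c hc => mul_nonneg (hφ c) ((hpq c hc).1 k j)
      · intro k hk S'
        dsimp only
        split_ifs with hki
        · subst hki
          refine le_trans (le_of_eq ?_) (hmax S')
          exact sum_congr rfl fun j _ => mul_comm _ _
        · have hkL : k ∈ L := (List.mem_cons.1 hk).resolve_left hki
          simp only [mul_sum]
          rw [sum_comm]
          refine sum_le_sum fun c hc => ?_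
          refine le_trans (le_of_eq ?_)
            (mul_le_mul_of_nonneg_left ((hpq c hc).2.1 k hkL S') (hφ c))
          rw [mul_sum]
          exact sum_congr rfl fun j _ => by ring
      · rw [List.toFinset_cons, sum_insert (by simpa using hiL), if_pos rfl, ← add_assoc, ← hdrift]
        have : ∑ k ∈ L.toFinset, (if k = i' then I.greedyObjective i' B S else
            ∑ c ∈ insertNone S, I.custProb i' c S * (pq c).2 k) =
            ∑ c ∈ insertNone S, I.custProb i' c S * ∑ k ∈ L.toFinset, (pq c).2 k := by
          simp only [mul_sum]
          rw [sum_comm]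
          refine sum_congr rfl fun k hk => if_neg ?_
          rintro rfl
          exact hiL (by simpa using hk)
        rw [this, revenue, ← sum_add_distrib]
        exact sum_congr rfl fun c hc => by rw [← (hpq c hc).2.2.1, mul_add]
      · intro X O hBX hX hO
        have hXi : ∀ j, ∀ k ∈ X j, I.r i' j ≤ I.r k j := fun j k hk => hX j k hk i' (by simp)
        -- The bound is proved in each branch separately and averaged at the end.
        have key : ∀ c ∈ insertNone S, ∑ j, I.g j (X j ∪ O j) ≤
            ∑ j, (I.g j (X j) - I.g j (B j)) + I.revenue (next c) +
              ∑ j, ∑ k ∈ O j, (if k = i' then I.marginal j i' (B j) else (pq c).1 k j) := by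
          intro c hc
          -- Insert `i'` where the comparison solution wants her, and also where greedy puts her, so
          -- that the enlarged backlogs still contain those of the run.
          let X' : Backlogs n m := fun j =>
            if i' ∈ O j ∨ c = some j then insert i' (X j) else X j
          have hXX' : ∀ j, X j ⊆ X' j := fun j => by
            simp only [X']; split_ifs
            exacts [subset_insert _ _, Subset.rfl]
          have h := (hpq c hc).2.2.2 X' (fun j => (O j).erase i') ?_ ?_ ?_
          · have hle : ∑ j, I.g j (X j ∪ O j) ≤ ∑ j, I.g j (X' j ∪ (O j).erase i') := by
              refine sum_le_sum fun j _ => I.g_mono j fun k hk => ?_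
              rcases mem_union.1 hk with hk | hk
              · exact mem_union_left _ (hXX' j hk)
              · by_cases hki : k = i'
                · subst hki
                  exact mem_union_left _ (by simp [X', hk])
                · exact mem_union_right _ (mem_erase.2 ⟨hki, hk⟩)
            have hstep : ∀ j, (I.g j (X' j) - I.g j (B.record i' c j)) +
                ∑ k ∈ (O j).erase i', (pq c).1 k j ≤ (I.g j (X j) - I.g j (B j)) +
                ∑ k ∈ O j, (if k = i' then I.marginal j i' (B j) else (pq c).1 k j) := by
              intro j
              have h1 : ∑ k ∈ (O j).erase i', (if k = i' then I.marginal j i' (B j) else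
                  (pq c).1 k j) = ∑ k ∈ (O j).erase i', (pq c).1 k j :=
                sum_congr rfl fun k hk => if_neg (ne_of_mem_erase hk)
              have hanti : I.marginal j i' (X j) ≤ I.marginal j i' (B j) :=
                I.marginal_anti (hBX j) (hXi j)
              have hpos := I.marginal_nonneg j i' (B j)
              have hB1 : c = some j → B.record i' c j = insert i' (B j) := by
                rintro rfl; simp [Backlogs.record]
              have hB2 : c ≠ some j → B.record i' c j = B j := by
                intro hne
                cases c with
                | none => rfl
                | some j' => exact Function.update_of_ne (fun h => hne (by rw [h])) _ _
              simp only [marginal] at hanti hpos h1 ⊢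
              -- If `i'` enters `X j`, the gain is at most her marginal at `B j`. It is paid by her
              -- price when `i' ∈ O j`, or by the growth of the greedy backlog when `c = some j`; if
              -- both hold, one payment is left over and `hpos` discards it.
              by_cases hi : i' ∈ O j
              · rw [← add_sum_erase _ _ hi, if_pos rfl, h1]
                by_cases hcj : c = some j
                · rw [hB1 hcj]; simp only [X', hi, true_or, if_true]; linarith
                · rw [hB2 hcj]; simp only [X', hi, true_or, if_true]; linarith
              · rw [erase_eq_of_notMem hi] at h1 ⊢
                rw [h1]
                by_cases hcj : c = some j
                · rw [hB1 hcj]; simp only [X', hcj, or_true, if_true]; linarith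
                · rw [hB2 hcj]; simp only [X', hi, hcj, or_self, if_false]; linarith
            have h2 := sum_le_sum fun j (_ : j ∈ univ) => hstep j
            rw [sum_add_distrib, sum_add_distrib] at h2
            linarith
          · intro j
            cases c with
            | none => exact (hBX j).trans (hXX' j)
            | some j' =>
              by_cases hj : j' = j
              · subst hj
                simpa [Backlogs.record, X'] using insert_subset_insert i' (hBX j')
              · rw [show B.record i' (some j') j = B j from
                  Function.update_of_ne (fun h => hj h.symm) _ _]
                exact (hBX j).trans (hXX' j)
          -- The common order keeps the induction going: `i'` is worth at least as much as every
          -- customer still to come.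
          · intro j k hk i hi
            have : k = i' ∨ k ∈ X j := by
              simp only [X'] at hk; split_ifs at hk
              exacts [mem_insert.1 hk, Or.inr hk]
            rcases this with rfl | hk
            · exact his i hi j
            · exact hX j k hk i (by simp [hi])
          · intro j k hk
            have := hO j (mem_of_mem_erase hk)
            simpa [ne_of_mem_erase hk] using this
        have h := sum_le_sum fun c hc => mul_le_mul_of_nonneg_left (key c hc) (hφ c)
        rw [← sum_mul, hsum, one_mul] at h
        refine h.trans (le_of_eq ?_)
        simp only [mul_add, sum_add_distrib]
        rw [← sum_mul, hsum, one_mul, revenue]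
        congr 1
        simp only [mul_sum]
        rw [sum_comm]
        refine sum_congr rfl fun j _ => ?_
        rw [sum_comm]
        refine sum_congr rfl fun k _ => ?_
        split_ifs
        · rw [← sum_mul, hsum, one_mul]
        · rfl

theorem IsGreedy.half_OPT_le {L : List (Fin n)} {P : Policy n m}
    (hP : I.IsGreedy L (fun _ => ∅) P) (hL : L.Nodup) (hmem : ∀ i, i ∈ L)
    (hs : L.Pairwise fun i k => ∀ j, I.r k j ≤ I.r i j) : (1 / 2 : ℝ) * I.OPT ≤ I.revenue P := by
  obtain ⟨p, q, hp, hq, hrev, hO⟩ := hP.exists_prices I hL hs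
  have huniv : L.toFinset = univ := by ext i; simp [hmem i]
  have h := I.valueToGo_le (c := I.revenue P) hp (fun i S => hq i (hmem i) S)
    (fun B => by simpa using hO (fun _ => ∅) B (by simp) (by simp) (by simp [huniv]))
    n univ (fun _ => ∅)
  simp only [huniv, g_empty, sum_const_zero, zero_add] at hrev
  simp only [sum_empty, sum_const_zero, hrev] at h
  rw [OPT]
  linarith

theorem IsGreedy.feasible {L : List (Fin n)} {B : Backlogs n m} {P : Policy n m}
    (hP : I.IsGreedy L B P) (hL : L.Nodup) : P.Feasible L.toFinset B := by
  induction L generalizing B P with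
  | nil =>
    cases P with
    | offer => exact hP.elim
    | finish D => exact ⟨rfl, fun j => (hP j).1⟩
  | cons i L ih =>
    cases P with
    | finish => exact hP.elim
    | offer i' S next =>
      obtain ⟨rfl, -, hnext⟩ := hP
      obtain ⟨hiL, hL⟩ := List.nodup_cons.1 hL
      refine ⟨by simp, fun c hc => ?_⟩
      rw [List.toFinset_cons, erase_insert (by simpa using hiL)]
      exact ih (hnext c hc) hL

end Instance

/-! ## Results and running times of the elementary computations -/

@[simp] theorem Timed.bind_val {α β : Type} (x : Timed α) (f : α → Timed β) :
    (x >>= f).val = (f x.val).val := rfl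

@[simp] theorem Timed.bind_time {α β : Type} (x : Timed α) (f : α → Timed β) :
    (x >>= f).time = x.time + (f x.val).time := rfl

@[simp] theorem step_val {α : Type} (a : α) : (step a).val = a := rfl

@[simp] theorem step_time {α : Type} (a : α) : (step a).time = 1 := rfl

@[simp] theorem forEach_val {α β : Type} (f : α → Timed β) (l : List α) :
    (forEach f l).val = l.map fun x => (f x).val := by
  induction l with
  | nil => rfl
  | cons x l ih => simp [forEach, ih]

theorem forEach_time_le {α β : Type} {f : α → Timed β} {K : ℕ} {l : List α}
    (h : ∀ x ∈ l, (f x).time ≤ K) : (forEach f l).time ≤ l.length * (K + 1) + 1 := by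
  induction l with
  | nil => simp [forEach]
  | cons x l ih =>
    have h1 := h x (by simp)
    have h2 := ih fun y hy => h y (by simp [hy])
    simp only [forEach, Timed.bind_time, step_time, List.length_cons]
    linarith

theorem insertDesc_perm {α : Type} (key : α → ℝ) (x : α) (l : List α) :
    (insertDesc key x l).val.Perm (x :: l) := by
  induction l with
  | nil => exact List.Perm.refl _
  | cons y l ih =>
    simp only [insertDesc, Timed.bind_val, step_val, decide_eq_true_eq]
    split_ifs
    · exact List.Perm.refl _
    · exact (ih.cons y).trans (List.Perm.swap x y l)

theorem insertDesc_pairwise {α : Type} {key : α → ℝ} (x : α) {l : List α}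
    (hl : l.Pairwise fun y z => key z ≤ key y) :
    (insertDesc key x l).val.Pairwise fun y z => key z ≤ key y := by
  induction l with
  | nil => exact List.pairwise_singleton _ _
  | cons y l ih =>
    have hy := List.pairwise_cons.1 hl
    simp only [insertDesc, Timed.bind_val, step_val, decide_eq_true_eq]
    split_ifs with h
    · refine List.pairwise_cons.2 ⟨fun z hz => ?_, hl⟩
      rcases List.mem_cons.1 hz with rfl | hz
      · exact h
      · exact (hy.1 z hz).trans h
    · refine List.pairwise_cons.2 ⟨fun z hz => ?_, ih hy.2⟩
      rcases List.mem_cons.1 ((insertDesc_perm key x l).mem_iff.1 hz) with rfl | hz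
      · exact (not_le.1 h).le
      · exact hy.1 z hz

theorem insertDesc_time_le {α : Type} (key : α → ℝ) (x : α) (l : List α) :
    (insertDesc key x l).time ≤ 2 * l.length + 1 := by
  induction l with
  | nil => simp [insertDesc]
  | cons y l ih =>
    simp only [insertDesc, Timed.bind_time, step_val, step_time, decide_eq_true_eq,
      List.length_cons]
    split_ifs
    · simp; omega
    · simp; omega

theorem sortDesc_perm {α : Type} (key : α → ℝ) (l : List α) : (sortDesc key l).val.Perm l := by
  induction l with
  | nil => exact List.Perm.refl _
  | cons x l ih => exact (insertDesc_perm key x _).trans (ih.cons x)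

theorem sortDesc_pairwise {α : Type} (key : α → ℝ) (l : List α) :
    (sortDesc key l).val.Pairwise fun y z => key z ≤ key y := by
  induction l with
  | nil => exact List.Pairwise.nil
  | cons x l ih => exact insertDesc_pairwise x ih

theorem sortDesc_time_le {α : Type} (key : α → ℝ) (l : List α) :
    (sortDesc key l).time ≤ (l.length + 1) ^ 2 := by
  induction l with
  | nil => simp [sortDesc]
  | cons x l ih =>
    have h := insertDesc_time_le key x (sortDesc key l).val
    rw [(sortDesc_perm key l).length_eq] at h
    simp only [sortDesc, Timed.bind_time, List.length_cons]
    nlinarith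

theorem scan_cons {ι : Type} (x : Item ι) (l : List (Item ι)) (num den : ℝ) (pre : List ι)
    (best : ℝ) (bestPre : List ι) :
    scan (x :: l) num den pre best bestPre =
      let v := (num + x.rev * x.wt) / (den + x.wt)
      let res := if best < v then
          scan l (num + x.rev * x.wt) (den + x.wt) (x.label :: pre) v (x.label :: pre)
        else scan l (num + x.rev * x.wt) (den + x.wt) (x.label :: pre) best bestPre
      ⟨res.val, res.time + 6⟩ := by
  by_cases h : best < (num + x.rev * x.wt) / (den + x.wt) <;>
    simp [scan, h, bind, step] <;> ring

theorem scan_time_le {ι : Type} (l : List (Item ι)) (num den : ℝ) (pre : List ι) (best : ℝ)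
    (bestPre : List ι) : (scan l num den pre best bestPre).time ≤ 6 * l.length + 1 := by
  induction l generalizing num den pre best bestPre with
  | nil => simp [scan]
  | cons x l ih =>
    simp only [scan_cons, List.length_cons]
    split_ifs
    · have := ih (num + x.rev * x.wt) (den + x.wt) (x.label :: pre)
        ((num + x.rev * x.wt) / (den + x.wt)) (x.label :: pre)
      omega
    · have := ih (num + x.rev * x.wt) (den + x.wt) (x.label :: pre) best bestPre
      omega

theorem mnlOpt_time_le {ι : Type} (l : List (Item ι)) :
    (mnlOpt l).time ≤ (l.length + 1) ^ 2 + (6 * l.length + 1) := by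
  have h := scan_time_le (sortDesc Item.rev l).val 0 1 [] 0 []
  rw [(sortDesc_perm Item.rev l).length_eq] at h
  exact add_le_add (sortDesc_time_le _ _) h

@[simp] theorem sumList_time (l : List ℝ) : (Instance.sumList l).time = l.length + 1 := by
  induction l with
  | nil => rfl
  | cons x l ih => simp [Instance.sumList, ih]

@[simp] theorem sumList_val (l : List ℝ) : (Instance.sumList l).val = l.sum := by
  induction l with
  | nil => rfl
  | cons x l ih => simp [Instance.sumList, ih]

/-! ## Assortment optimization by the best prefix -/

/-- Descending order makes every superlevel set of `a` an initial segment, with ties at `z` excluded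
together. -/
theorem exists_prefix_mem_iff {ι : Type} {a : ι → ℝ} {l : List ι} (hl : l.Pairwise fun x y => a y ≤ a x) (z : ℝ) :
    ∃ t, t <+: l ∧ ∀ x ∈ l, x ∈ t ↔ z < a x := by
  induction l with
  | nil => exact ⟨[], List.prefix_rfl, by simp⟩
  | cons x l ih =>
    obtain ⟨hx, hl⟩ := List.pairwise_cons.1 hl
    by_cases hz : z < a x
    · obtain ⟨t, ht, h⟩ := ih hl
      refine ⟨x :: t, (List.prefix_cons_inj x).2 ht, fun y hy => ?_⟩
      by_cases hyx : y = x
      · simp [hyx, hz]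
      · simpa [hyx] using h y ((List.mem_cons.1 hy).resolve_left hyx)
    · refine ⟨[], List.nil_prefix, fun y hy => ?_⟩
      have : a y ≤ z := by
        rcases List.mem_cons.1 hy with rfl | hy
        · exact not_lt.1 hz
        · exact (hx y hy).trans (not_lt.1 hz)
      simp [this]

section mnlOpt

variable {ι : Type} [DecidableEq ι] {a v : ι → ℝ}

/-- Loop invariant of the scan. The list `pre` is accumulated in reverse, which is harmless because
only its set of labels matters. -/
theorem scan_spec {l pre bestPre : List ι} {best : ℝ} (hl : (pre ++ l).Nodup)
    (hpre : mnlRevenue a v pre.toFinset ≤ best) (hb : best = mnlRevenue a v bestPre.toFinset) :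
    let res := (scan (l.map fun x => Item.mk x (a x) (v x)) (∑ x ∈ pre.toFinset, a x * v x)
      (1 + ∑ x ∈ pre.toFinset, v x) pre best bestPre).val
    (res.2 ⊆ bestPre ∨ res.2 ⊆ pre ++ l) ∧ res.1 = mnlRevenue a v res.2.toFinset ∧ best ≤ res.1 ∧
      ∀ t, t <+: l → mnlRevenue a v (pre ++ t).toFinset ≤ res.1 := by
  induction l generalizing pre bestPre best with
  | nil =>
    refine ⟨Or.inl (List.Subset.refl _), hb, le_rfl, fun t ht => ?_⟩
    rw [List.prefix_nil.1 ht, List.append_nil]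
    exact hpre
  | cons x l ih =>
    have hperm : (pre ++ x :: l).Perm (x :: pre ++ l) := List.perm_middle
    have hl' : (x :: pre ++ l).Nodup := hperm.nodup_iff.1 hl
    have hx : x ∉ pre.toFinset := by
      have : x ∉ pre ++ l := (List.nodup_cons.1 hl').1
      exact fun h => this (List.mem_append_left _ (List.mem_toFinset.1 h))
    have hnum : ∑ y ∈ pre.toFinset, a y * v y + a x * v x =
        ∑ y ∈ (x :: pre).toFinset, a y * v y := by
      rw [List.toFinset_cons, sum_insert hx, add_comm]
    have hden : 1 + ∑ y ∈ pre.toFinset, v y + v x = 1 + ∑ y ∈ (x :: pre).toFinset, v y := by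
      rw [List.toFinset_cons, sum_insert hx]; ring
    have hsub : ∀ s : List ι, s ⊆ x :: pre ++ l → s ⊆ pre ++ x :: l := fun s hs y hy =>
      hperm.mem_iff.2 (hs hy)
    have hpfx : ∀ z, mnlRevenue a v pre.toFinset ≤ z →
        (∀ t, t <+: l → mnlRevenue a v (x :: pre ++ t).toFinset ≤ z) →
        ∀ t, t <+: x :: l → mnlRevenue a v (pre ++ t).toFinset ≤ z := by
      intro z hz h t ht
      rcases List.prefix_cons_iff.1 ht with rfl | ⟨t, rfl, ht'⟩
      · simpa using hz
      · rw [List.toFinset_eq_of_perm _ _ (List.perm_middle (l₁ := pre) (l₂ := t) (a := x))]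
        exact h t ht'
    simp only [List.map_cons, scan_cons, hnum, hden]
    rw [show (∑ y ∈ (x :: pre).toFinset, a y * v y) / (1 + ∑ y ∈ (x :: pre).toFinset, v y) =
      mnlRevenue a v (x :: pre).toFinset from rfl]
    split_ifs with hlt
    · obtain ⟨h1, h2, h3, h4⟩ := ih (bestPre := x :: pre) hl' le_rfl rfl
      refine ⟨Or.inr (hsub _ ?_), h2, hlt.le.trans h3, hpfx _ (hpre.trans (hlt.le.trans h3)) h4⟩
      rcases h1 with h1 | h1
      · exact fun y hy => List.mem_append_left _ (h1 hy)
      · exact h1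
    · obtain ⟨h1, h2, h3, h4⟩ := ih (bestPre := bestPre) hl' (not_lt.1 hlt) hb
      exact ⟨h1.imp_right (hsub _), h2, h3, hpfx _ (hpre.trans h3) h4⟩

/-- Among all assortments, some prefix in descending order of revenue is optimal. -/
theorem mnlOpt_spec (hv : ∀ x, 0 ≤ v x) {l : List ι} (hl : l.Nodup) :
    let res := (mnlOpt (l.map fun x => Item.mk x (a x) (v x))).val
    res.2 ⊆ l ∧ res.1 = mnlRevenue a v res.2.toFinset ∧
      ∀ C ⊆ l.toFinset, mnlRevenue a v C ≤ res.1 := by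
  set items := l.map fun x => Item.mk x (a x) (v x) with hitems
  obtain ⟨l', hl', hmap⟩ : ∃ l' : List ι, l'.Perm l ∧
      (sortDesc Item.rev items).val = l'.map fun x => Item.mk x (a x) (v x) := by
    have hp := sortDesc_perm Item.rev items
    refine ⟨(sortDesc Item.rev items).val.map Item.label, ?_, ?_⟩
    · simpa [hitems, Function.comp_def] using hp.map Item.label
    · rw [List.map_map]
      refine (List.map_id _).symm.trans (List.map_congr_left fun y hy => ?_)
      have := hp.mem_iff.1 hy
      rw [hitems, List.mem_map] at this
      obtain ⟨x, -, rfl⟩ := this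
      rfl
  have hsort := sortDesc_pairwise Item.rev items
  rw [hmap, List.pairwise_map] at hsort
  have hres : (mnlOpt items).val = (scan (l'.map fun x => Item.mk x (a x) (v x)) 0 1 [] 0 []).val := by
    rw [← hmap]; rfl
  obtain ⟨h1, h2, h3, h4⟩ := scan_spec (a := a) (v := v) (l := l') (pre := []) (bestPre := [])
    (best := 0) (by simpa using hl'.nodup_iff.2 hl) (by simp) (by simp)
  simp only [List.toFinset_nil, sum_empty, add_zero, ← hres, List.nil_append] at h1 h2 h3 h4
  have h1' : (mnlOpt items).val.2 ⊆ l := fun x hx => by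
    rcases h1 with h1 | h1
    · exact absurd (h1 hx) (by simp)
    · exact hl'.mem_iff.1 (h1 hx)
  refine ⟨h1', h2, fun C hC => ?_⟩
  -- The threshold is the value found by the scan. The prefix above it was examined, so its revenue
  -- does not exceed that value, and then neither does that of any other assortment.
  obtain ⟨t, ht, hmem⟩ := exists_prefix_mem_iff hsort (mnlOpt items).val.1
  refine mnlRevenue_le_of_threshold hv hC (T := t.toFinset) ?_ ?_ (h4 t ht)
  · intro x hx
    rw [List.mem_toFinset] at hx
    exact ((hmem x (ht.subset hx)).1 hx).le
  · intro x hx hxt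
    rw [List.mem_toFinset] at hx hxt
    exact not_lt.1 fun h => hxt ((hmem x (hl'.mem_iff.2 hx)).2 h)

end mnlOpt

namespace Instance

variable {n m : ℕ} (I : Instance n m)

/-! ## The implementation is a greedy run -/

theorem bestSubset_spec (j : Fin m) {L : List (Fin n)} (hL : L.Nodup) :
    (I.bestSubset j L).val.2.toFinset ⊆ L.toFinset ∧
      (I.bestSubset j L).val.1 = I.g j L.toFinset ∧
      ∀ C ⊆ L.toFinset, I.R j C ≤ I.R j (I.bestSubset j L).val.2.toFinset := by
  have hval : (I.bestSubset j L).val =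
      (mnlOpt (L.map fun i => Item.mk i (I.r i j) (I.w j i))).val := by
    simp [bestSubset]
  obtain ⟨h1, h2, h3⟩ := mnlOpt_spec (a := fun i => I.r i j) (I.w_nonneg j) hL
  simp only [← hval, ← R_eq] at h1 h2 h3
  have hsub : (I.bestSubset j L).val.2.toFinset ⊆ L.toFinset := fun x hx => by
    rw [List.mem_toFinset] at hx ⊢
    exact h1 hx
  have hmax : ∀ C ⊆ L.toFinset, I.R j C ≤ I.R j (I.bestSubset j L).val.2.toFinset :=
    fun C hC => h2 ▸ h3 C hC
  exact ⟨hsub, h2.trans (I.g_eq_of_forall_le hsub hmax).symm, hmax⟩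

theorem greedyOffer_spec (i : Fin n) {B : Fin m → List (Fin n)} (hB : ∀ j, (i :: B j).Nodup)
    (S : Finset (Fin m)) :
    I.greedyObjective i (fun j => (B j).toFinset) S ≤
      I.greedyObjective i (fun j => (B j).toFinset) (I.greedyOffer i B).val.toFinset := by
  have hval : (I.greedyOffer i B).val = (mnlOpt ((List.finRange m).map fun j =>
      Item.mk j (I.marginal j i (B j).toFinset) (I.u i j))).val.2 := by
    have h : ∀ j, (I.bestSubset j (i :: B j)).val.1 - (I.bestSubset j (B j)).val.1 =
        I.marginal j i (B j).toFinset := fun j => by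
      rw [(I.bestSubset_spec j (hB j)).2.1, (I.bestSubset_spec j (List.nodup_cons.1 (hB j)).2).2.1,
        marginal, List.toFinset_cons]
    simp [greedyOffer, h]
  obtain ⟨-, h2, h3⟩ := mnlOpt_spec (a := fun j => I.marginal j i (B j).toFinset) (I.u_nonneg i)
    (List.nodup_finRange m)
  rw [greedyObjective_eq, greedyObjective_eq, hval, ← h2]
  exact h3 S fun j _ => by simp

theorem recordList_toFinset (B : Fin m → List (Fin n)) (i : Fin n) (c : Option (Fin m)) :
    (fun j => (recordList B i c j).toFinset) = Backlogs.record (fun j => (B j).toFinset) i c := by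
  funext j
  cases c with
  | none => rfl
  | some j' =>
    by_cases h : j = j'
    · subst h; simp [recordList, Backlogs.record]
    · simp [recordList, Backlogs.record, h]

/-- Recording a choice moves a customer from the pending list to at most one backlog.
Duplicate-freeness of each `L ++ B j` therefore persists, and the lists represent the backlog sets
faithfully. -/
theorem isGreedy_greedyRun {L : List (Fin n)} {B : Fin m → List (Fin n)}
    (h : ∀ j, (L ++ B j).Nodup) (hL : L.Nodup) :
    I.IsGreedy L (fun j => (B j).toFinset) (I.greedyRun L B).val := by
  induction L generalizing B with
  | nil =>
    intro j
    obtain ⟨h1, -, h3⟩ := I.bestSubset_spec j (h j)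
    exact ⟨h1, h3⟩
  | cons i L ih =>
    refine ⟨rfl, I.greedyOffer_spec i fun j => ?_, fun c _ => ?_⟩
    · exact (h j).sublist ((List.sublist_append_right L (B j)).cons_cons i)
    · rw [← recordList_toFinset]
      refine ih (fun j => ?_) (List.nodup_cons.1 hL).2
      cases c with
      | none => exact (List.nodup_cons.1 (h j)).2
      | some j' =>
        by_cases hj : j = j'
        · subst hj
          simp only [recordList, Function.update_self]
          exact List.perm_middle.nodup_iff.2 (h j)
        · simp only [recordList, Function.update_of_ne hj]
          exact (List.nodup_cons.1 (h j)).2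

theorem customerOrder_val :
    I.customerOrder.val = ((sortDesc Prod.snd
      ((List.finRange n).map fun i => (i, ∑ j, I.r i j))).val).map Prod.fst := by
  simp [customerOrder, ← Fin.sum_univ_def]

theorem customerOrder_perm : I.customerOrder.val.Perm (List.finRange n) := by
  rw [customerOrder_val]
  simpa [Function.comp_def] using ((sortDesc_perm Prod.snd
    ((List.finRange n).map fun i => (i, ∑ j, I.r i j))).map Prod.fst)

theorem customerOrder_pairwise :
    I.customerOrder.val.Pairwise fun i k => ∑ j, I.r k j ≤ ∑ j, I.r i j := by
  rw [customerOrder_val, List.pairwise_map]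
  refine (sortDesc_pairwise Prod.snd _).imp_of_mem fun {x y} hx hy hxy => ?_
  have hmem : ∀ x ∈ (sortDesc Prod.snd
      ((List.finRange n).map fun i => (i, ∑ j, I.r i j))).val, x.2 = ∑ j, I.r x.1 j := by
    intro x hx
    have := (sortDesc_perm _ _).mem_iff.1 hx
    rw [List.mem_map] at this
    obtain ⟨i, -, rfl⟩ := this
    rfl
  rwa [← hmem x hx, ← hmem y hy]

theorem IsCommonOrder.pairwise {σ : Equiv.Perm (Fin n)} (hσ : I.IsCommonOrder σ) :
    ((List.finRange n).map σ).Pairwise fun i k => ∀ j, I.r k j ≤ I.r i j := by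
  rw [List.pairwise_map]
  exact (List.pairwise_lt_finRange n).imp fun h j => hσ j _ _ h.le

/-- If the suppliers have a common order, then the order by total revenue is one. -/
theorem exists_isCommonOrder_customerOrder (h : ∃ σ, I.IsCommonOrder σ) :
    ∃ σ, I.IsCommonOrder σ ∧ (List.finRange n).map σ = I.customerOrder.val := by
  obtain ⟨τ, hτ⟩ := h
  have hperm := I.customerOrder_perm
  have hlen : I.customerOrder.val.length = n := by simpa using hperm.length_eq
  have hnodup : I.customerOrder.val.Nodup := hperm.nodup_iff.2 (List.nodup_finRange n)
  let f : Fin n → Fin n := fun t => I.customerOrder.val.get (t.cast hlen.symm)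
  have hf : Function.Injective f := fun s t hst => by
    simpa using (List.nodup_iff_injective_get.1 hnodup) hst
  refine ⟨Equiv.ofBijective f (Finite.injective_iff_bijective.1 hf), fun j s t hst => ?_, ?_⟩
  · rcases hst.eq_or_lt with rfl | hlt
    · exact le_rfl
    have hsum : ∑ j, I.r (f t) j ≤ ∑ j, I.r (f s) j :=
      List.pairwise_iff_get.1 I.customerOrder_pairwise (s.cast hlen.symm) (t.cast hlen.symm) hlt
    change I.r (f t) j ≤ I.r (f s) j
    -- If `τ` orders the two customers the other way, its entrywise inequalities together with the
    -- reverse inequality of totals force equality for every supplier.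
    rcases le_total (τ.symm (f s)) (τ.symm (f t)) with hle | hle
    · simpa using hτ j _ _ hle
    · have hge : ∀ j ∈ univ, I.r (f s) j ≤ I.r (f t) j := fun j _ => by
        simpa using hτ j _ _ hle
      exact ((sum_eq_sum_iff_of_le hge).1 (le_antisymm (sum_le_sum hge) hsum) j
        (mem_univ j)).ge
  · refine List.ext_getElem (by simp [hlen]) fun k h1 h2 => ?_
    simp [f]

/-! ## The running time -/

theorem bestSubset_time_le (j : Fin m) (L : List (Fin n)) :
    (I.bestSubset j L).time ≤ 10 * (L.length + 1) ^ 2 := by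
  have h1 : ∀ f : Fin n → Timed (Item (Fin n)), (∀ i, (f i).time = 3) →
      (forEach f L).time ≤ L.length * 4 + 1 := fun f hf =>
    forEach_time_le fun i _ => (hf i).le
  have h2 := mnlOpt_time_le (L.map fun i => Item.mk i (I.r i j) (I.w j i))
  rw [List.length_map] at h2
  simp only [bestSubset, Timed.bind_time]
  refine (add_le_add (h1 _ fun i => by simp) (by simpa using h2)).trans ?_
  nlinarith

theorem greedyOffer_time_le (i : Fin n) {B : Fin m → List (Fin n)} (hB : ∀ j, (B j).length < n) :
    (I.greedyOffer i B).time ≤ 40 * (n + m + 1) ^ 3 := by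
  have hbest : ∀ j (L : List (Fin n)), L.length ≤ n →
      (I.bestSubset j L).time ≤ 10 * (n + 1) ^ 2 := fun j L hL =>
    (I.bestSubset_time_le j L).trans (by gcongr)
  -- Per supplier: two calls of `bestSubset`, at most `10 * (n + 1) ^ 2` each, and five single
  -- steps.
  have h1 : ∀ f : Fin m → Timed (Item (Fin m)), (∀ j, (f j).time ≤ 20 * (n + 1) ^ 2 + 5) →
      (forEach f (List.finRange m)).time ≤ m * (20 * (n + 1) ^ 2 + 6) + 1 := fun f hf => by
    simpa using forEach_time_le (l := List.finRange m) fun j _ => hf j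
  have h2 := mnlOpt_time_le ((List.finRange m).map fun j => Item.mk j
    ((I.bestSubset j (i :: B j)).val.1 - (I.bestSubset j (B j)).val.1) (I.u i j))
  rw [List.length_map, List.length_finRange] at h2
  simp only [greedyOffer, Timed.bind_time, step_time]
  refine (add_le_add (h1 _ fun j => ?_)
    (Nat.add_le_add_right (by simpa using h2) 1)).trans ?_
  · have := hbest j (B j) (hB j).le
    have := hbest j (i :: B j) (hB j)
    simp only [Timed.bind_time, step_time, step_val]
    omega
  · have hm : m ≤ n + m + 1 := by omega
    have h1 : n + 1 ≤ n + m + 1 := by omega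
    have h2 : m + 1 ≤ n + m + 1 := by omega
    have h3 : 1 ≤ n + m + 1 := by omega
    generalize n + m + 1 = N at *
    calc m * (20 * (n + 1) ^ 2 + 6) + 1 + ((m + 1) ^ 2 + (6 * m + 1) + 1)
        ≤ N * (20 * N ^ 2 + 6) + 1 + (N ^ 2 + (6 * N + 1) + 1) := by gcongr
      _ = 20 * N ^ 3 + N ^ 2 + 12 * N + 3 := by ring
      _ ≤ 20 * N ^ 3 + N ^ 3 + 12 * N ^ 3 + 3 * N ^ 3 := by
        have e1 : N ^ 2 ≤ N ^ 3 := Nat.pow_le_pow_right h3 (by norm_num)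
        have e2 : N ≤ N ^ 3 := Nat.le_self_pow (by norm_num) N
        omega
      _ ≤ 40 * N ^ 3 := by omega

/-- A backlog grows only when the pending list shrinks, so backlog lengths never exceed `n`. The
bound is the same for every choice and thus survives the supremum over choices. -/
theorem greedyRun_time_le {L : List (Fin n)} {B : Fin m → List (Fin n)}
    (hB : ∀ j, (B j).length + L.length ≤ n) :
    (I.greedyRun L B).time ≤
      L.length * (40 * (n + m + 1) ^ 3 + 2) + m * (10 * (n + 1) ^ 2 + 1) := by
  induction L generalizing B with
  | nil =>
    simp only [greedyRun, List.length_nil, zero_mul, zero_add]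
    refine (sum_le_card_nsmul univ _ (10 * (n + 1) ^ 2 + 1) fun j _ => ?_).trans (by simp)
    have : (B j).length ≤ n := hB j
    exact Nat.add_le_add_right ((I.bestSubset_time_le j (B j)).trans (by gcongr)) 1
  | cons i L ih =>
    have h1 := I.greedyOffer_time_le i (B := B) fun j => by
      have := hB j
      simp only [List.length_cons] at this
      omega
    have h2 : (univ.sup fun c : Option (Fin m) => (I.greedyRun L (recordList B i c)).time) ≤
        L.length * (40 * (n + m + 1) ^ 3 + 2) + m * (10 * (n + 1) ^ 2 + 1) := by
      refine Finset.sup_le fun c _ => ih fun j => ?_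
      have := hB j
      simp only [List.length_cons] at this
      cases c with
      | none => simp only [recordList]; omega
      | some j' =>
        by_cases hj : j = j'
        · subst hj; simp only [recordList, Function.update_self, List.length_cons]; omega
        · simp only [recordList, Function.update_of_ne hj]; omega
    simp only [greedyRun, List.length_cons, add_mul, one_mul] at h2 ⊢
    omega

theorem customerOrder_time_le : I.customerOrder.time ≤ 10 * (n + m + 1) ^ 2 := by
  have hrow : ∀ i, (forEach (fun j => step (I.r i j)) (List.finRange m)).time ≤ m * 2 + 1 :=
    fun i => (forEach_time_le (K := 1) fun j _ => le_rfl).trans (by simp)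
  -- Per customer: `2 * m + 1` steps to read the row, `m + 1` to sum it, and one to form the pair.
  have hitems : ∀ f : Fin n → Timed (Fin n × ℝ), (∀ i, (f i).time ≤ 3 * m + 3) →
      (forEach f (List.finRange n)).time ≤ n * (3 * m + 4) + 1 := fun f hf => by
    simpa using forEach_time_le (l := List.finRange n) fun i _ => hf i
  have hsort := sortDesc_time_le Prod.snd ((List.finRange n).map fun i => (i, ∑ j, I.r i j))
  have hlast : (forEach (fun p : Fin n × ℝ => step p.1) (sortDesc Prod.snd
      ((List.finRange n).map fun i => (i, ∑ j, I.r i j))).val).time ≤ n * 2 + 1 :=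
    (forEach_time_le (K := 1) fun _ _ => le_rfl).trans (by simp [(sortDesc_perm _ _).length_eq])
  rw [List.length_map, List.length_finRange] at hsort
  simp only [customerOrder, Timed.bind_time]
  refine (add_le_add (hitems _ fun i => ?_) (add_le_add (by simpa [← Fin.sum_univ_def] using hsort)
    (by simpa [← Fin.sum_univ_def] using hlast))).trans ?_
  · have := hrow i
    simp only [Timed.bind_time, step_time, sumList_time, forEach_val, List.length_map,
      List.length_finRange]
    omega
  · nlinarith

theorem sameOrderGreedy_time_le : I.sameOrderGreedy.time ≤ 100 * (n + m + 1) ^ 4 := by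
  have h1 := I.customerOrder_time_le
  have hlen : I.customerOrder.val.length = n := by simpa using I.customerOrder_perm.length_eq
  have h2 := I.greedyRun_time_le (L := I.customerOrder.val) (B := fun _ => []) (by simp [hlen])
  rw [hlen] at h2
  simp only [sameOrderGreedy]
  refine (add_le_add (Nat.add_le_add_right h1 m) h2).trans ?_
  have hn : n ≤ n + m + 1 := by omega
  have hm : m ≤ n + m + 1 := by omega
  have hn1 : n + 1 ≤ n + m + 1 := by omega
  have hpos : 1 ≤ n + m + 1 := by omega
  generalize n + m + 1 = N at *
  calc 10 * N ^ 2 + m + (n * (40 * N ^ 3 + 2) + m * (10 * (n + 1) ^ 2 + 1))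
      ≤ 10 * N ^ 2 + N + (N * (40 * N ^ 3 + 2) + N * (10 * N ^ 2 + 1)) := by gcongr
    _ = 40 * N ^ 4 + 10 * N ^ 3 + 10 * N ^ 2 + 4 * N := by ring
    _ ≤ 100 * N ^ 4 := by
      have e1 : N ^ 3 ≤ N ^ 4 := Nat.pow_le_pow_right hpos (by norm_num)
      have e2 : N ^ 2 ≤ N ^ 4 := Nat.pow_le_pow_right hpos (by norm_num)
      have e3 : N ≤ N ^ 4 := Nat.le_self_pow (by norm_num) N
      omega

end Instance
end ATAR

theorem theorem2 :
    ∃ a d : ℕ, ∀ (n m : ℕ) (I : ATAR.Instance n m),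
      (∃ σ : Equiv.Perm (Fin n), I.IsCommonOrder σ) →
        -- every run of the greedy algorithm, along any common order and with any tie-breaking
        (∀ σ : Equiv.Perm (Fin n), I.IsCommonOrder σ →
          ∀ P : ATAR.Policy n m, I.IsGreedy ((List.finRange n).map σ) (fun _ => ∅) P →
            P.Feasible Finset.univ (fun _ => ∅) ∧ (1 / 2 : ℝ) * I.OPT ≤ I.revenue P) ∧
        -- the concrete implementation is such a run, and its running time is polynomial
        (∃ σ : Equiv.Perm (Fin n), I.IsCommonOrder σ ∧
          I.IsGreedy ((List.finRange n).map σ) (fun _ => ∅) I.sameOrderGreedy.val) ∧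
        I.sameOrderGreedy.time ≤ a * (n + m + 1) ^ d := by
  refine ⟨100, 4, fun n m I h => ⟨fun σ hσ P hP => ?_, ?_, I.sameOrderGreedy_time_le⟩⟩
  · have hnodup : ((List.finRange n).map σ).Nodup := (List.nodup_finRange n).map σ.injective
    have hmem : ∀ i, i ∈ (List.finRange n).map σ := fun i => by simp [σ.surjective i]
    have huniv : ((List.finRange n).map σ).toFinset = Finset.univ :=
      Finset.eq_univ_of_forall fun i => List.mem_toFinset.2 (hmem i)
    exact ⟨huniv ▸ hP.feasible I hnodup, hP.half_OPT_le I hnodup hmem (hσ.pairwise I)⟩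
  · obtain ⟨σ, hσ, hmap⟩ := I.exists_isCommonOrder_customerOrder h
    have hnodup : I.customerOrder.val.Nodup :=
      I.customerOrder_perm.nodup_iff.2 (List.nodup_finRange n)
    refine ⟨σ, hσ, ?_⟩
    rw [hmap]
    exact I.isGreedy_greedyRun (B := fun _ => []) (fun _ => by simpa using hnodup) hnodup
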